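/- Let $\mathbb{R}^4_1$ be $\mathbb{R}^4$ with the flat Lorentzian metric $\langle x,y\rangle=-x_1y_1+x_2y_2+x_3y_3+x_4y_4$ and its standard orientation. Let $(N,h)$ be a connected oriented smooth Riemannian surface and $f:N\to\mathbb{R}^4_1$ a smooth isometric immersion. At $p\in N$ let $(e_1,e_2,e_3,e_4)$ be a positively oriented orthonormal basis of $\mathbb{R}^4_1$ with $e_1$ timelike such that $(e_3,e_4)$ is the image under $df_p$ of a positively oriented basis of $T_pN$; the line $\mathbb{R}(e_1+e_2)$ does not depend on the choice of the basis and is called the positive normal null line at $p$. The surface $f$ is called $+$isotropic if its second fundamental form $II(X,Y)$ (the normal component of the derivative of $df(Y)$ in the direction $X$) takes its values in the positive normal null line at every point. For a smooth function $\lambda:\mathbb{R}^2\to\mathbb{R}$ put $$i_\lambda:\mathbb{R}^2\to\mathbb{R}^4_1,\qquad i_\lambda(z_1,z_2)=(\lambda(z_1,z_2),\lambda(z_1,z_2),z_1,z_2).$$ Theorem. Let $f:(N,h)\to\mathbb{R}^4_1$ be $+$isotropic. 1. If $(N,h)$ is complete, then $(N,h)$ is isometric to the Euclidean plane $\mathbb{R}^2$.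 2. There is an isometry $\Phi$ of $\mathbb{R}^4_1$ such that every $p\in N$ has an open neighbourhood $U$, a smooth function $\lambda:\mathbb{R}^2\to\mathbb{R}$ and a diffeomorphism $\psi$ of $U$ onto an open subset of $\mathbb{R}^2$ with $\Phi\circ f=i_\lambda\circ\psi$ on $U$. If $(N,h)$ is complete, then moreover, for the same $\Phi$, there are a smooth function $\lambda:\mathbb{R}^2\to\mathbb{R}$ and an isometry $\varphi:N\to\mathbb{R}^2$ with $\Phi\circ f=i_\lambda\circ\varphi$ on all of $N$. -/

import Mathlib

open Bundle Manifold
open scoped ContDiff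

noncomputable section

namespace MinkowskiSurface

/-- The Euclidean plane, with its Euclidean norm. -/
abbrev Plane : Type := EuclideanSpace ℝ (Fin 2)

/-- The underlying vector space of Minkowski space, with its standard basis `u₀, u₁, u₂, u₃`
declared positively oriented. (The sup norm that `Fin 4 → ℝ` carries is used only for its
topology and smooth structure.) -/
abbrev R41 : Type := Fin 4 → ℝ

/-- The flat Lorentzian metric of signature `(3,1)`, with `u₀` timelike. -/
def minkowski (x y : R41) : ℝ := -(x 0 * y 0) + x 1 * y 1 + x 2 * y 2 + x 3 * y 3

/-- Isometries of Minkowski space: affine bijections whose linear part preserves the metric. -/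
def IsMinkowskiIsometry (Φ : R41 ≃ᵃ[ℝ] R41) : Prop :=
  ∀ v w : R41, minkowski (Φ.linear v) (Φ.linear w) = minkowski v w

/-- The map `i_lam : (z₁, z₂) ↦ (lam z, lam z, z₁, z₂)`. -/
def nullGraph (lam : Plane → ℝ) (z : Plane) : R41 := ![lam z, lam z, z 0, z 1]

section Surface

variable {N : Type*} [TopologicalSpace N] [ChartedSpace Plane N]

/-- The differential `df_p` of a map of a surface into Minkowski space, with values in `R41`. -/
def differential (f : N → R41) (p : N) : TangentSpace (𝓡 2) p →L[ℝ] R41 :=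
  mfderiv (𝓡 2) 𝓘(ℝ, R41) f p

/-- `X` is a smooth tangent vector field on the set `U`. -/
def IsSmoothFieldOn [IsManifold (𝓡 2) ∞ N] (U : Set N)
    (X : (q : N) → TangentSpace (𝓡 2) q) : Prop :=
  ContMDiffOn (𝓡 2) (𝓡 2).tangent ∞ (fun q => (⟨q, X q⟩ : TangentBundle (𝓡 2) N)) U

/-- A choice of orientations of the tangent planes is an orientation of the surface if near every
point there is a smooth frame that is positively oriented. -/
def IsSurfaceOrientation [IsManifold (𝓡 2) ∞ N]
    (o : (p : N) → Orientation ℝ (TangentSpace (𝓡 2) p) (Fin 2)) : Prop :=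
  ∀ p : N, ∃ U : Set N, IsOpen U ∧ p ∈ U ∧
    ∃ b : (q : N) → Module.Basis (Fin 2) ℝ (TangentSpace (𝓡 2) q),
      (∀ i, IsSmoothFieldOn U (fun q => b q i)) ∧ ∀ q ∈ U, (b q).orientation = o q

/-- `e` is a Darboux frame of `f` at `p`: a positively oriented orthonormal basis
`(e 0, e 1, e 2, e 3)` of Minkowski space, with `e 0` timelike, such that `(e 2, e 3)` is the image
under `df_p` of a positively oriented basis of the tangent plane. -/
structure IsDarbouxFrame (o : (p : N) → Orientation ℝ (TangentSpace (𝓡 2) p) (Fin 2))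
    (f : N → R41) (p : N) (e : Fin 4 → R41) : Prop where
  orthonormal : ∀ i j, minkowski (e i) (e j) = if i = j then (if i = 0 then -1 else 1) else 0
  det_pos : 0 < (Matrix.of e).det
  tangent : ∃ b : Module.Basis (Fin 2) ℝ (TangentSpace (𝓡 2) p),
    b.orientation = o p ∧ e 2 = differential f p (b 0) ∧ e 3 = differential f p (b 1)

variable [RiemannianBundle (fun p : N => TangentSpace (𝓡 2) p)]

instance (p : N) : FiniteDimensional ℝ (TangentSpace (𝓡 2) p) :=
  inferInstanceAs (FiniteDimensional ℝ Plane)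

/-- `f` is a smooth isometric immersion of the Riemannian surface `N` into Minkowski space.
(As the metric of `N` is positive definite, `df_p` is then injective with spacelike image.) -/
structure IsIsometricImmersion (f : N → R41) : Prop where
  smooth : ContMDiff (𝓡 2) 𝓘(ℝ, R41) ∞ f
  isometric : ∀ (p : N) (v w : TangentSpace (𝓡 2) p),
    minkowski (differential f p v) (differential f p w) = inner ℝ v w

/-- The component of `v` normal to the surface at `p`, for an isometric immersion `f`:
the tangential component is `∑ i, ⟨v, df b_i⟩ df b_i` for any orthonormal basis `b` of the tangent
plane. -/
def normalPart (f : N → R41) (p : N) (v : R41) : R41 :=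
  v - ∑ i, minkowski v (differential f p (stdOrthonormalBasis ℝ (TangentSpace (𝓡 2) p) i)) •
    differential f p (stdOrthonormalBasis ℝ (TangentSpace (𝓡 2) p) i)

/-- The second fundamental form `II(X, Y)` at `p`: the normal component of the derivative of
the vector field `df(Y)` along the surface in the direction `X`. The Levi-Civita connection of
Minkowski space is componentwise differentiation. -/
def secondFundamentalForm (f : N → R41) (X Y : (q : N) → TangentSpace (𝓡 2) q) (p : N) : R41 :=
  normalPart f p (differential (fun q => differential f q (Y q)) p (X p))

/-- `+`isotropic: the second fundamental form takes values in the positive normal null line,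
which is spanned by `e 0 + e 1` for any Darboux frame `e`. -/
def IsPlusIsotropic [IsManifold (𝓡 2) ∞ N]
    (o : (p : N) → Orientation ℝ (TangentSpace (𝓡 2) p) (Fin 2))
    (f : N → R41) : Prop :=
  ∀ (U : Set N), IsOpen U → ∀ (X Y : (q : N) → TangentSpace (𝓡 2) q),
    IsSmoothFieldOn U X → IsSmoothFieldOn U Y →
      ∀ p ∈ U, ∀ e : Fin 4 → R41, IsDarbouxFrame o f p e →
        secondFundamentalForm f X Y p ∈ Submodule.span ℝ {e 0 + e 1}

/-- The diffeomorphism `φ` of the Riemannian surface `N` onto the Euclidean plane is an isometry: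
its differential preserves the Riemannian metrics. -/
def IsIsometryToPlane (φ : N ≃ₘ^∞⟮𝓡 2, 𝓡 2⟯ Plane) : Prop :=
  ∀ (p : N) (v w : TangentSpace (𝓡 2) p),
    inner ℝ (mfderiv (𝓡 2) (𝓡 2) φ p v : Plane) (mfderiv (𝓡 2) (𝓡 2) φ p w : Plane) =
      inner ℝ v w

/-- Near `p`, and after the motion `Φ`, the map `f` is `i_lam` for a smooth function `lam` on the
plane, read in a smooth local coordinate system `ψ` of `N`. -/
def IsNullGraphNear (f : N → R41) (Φ : R41 ≃ᵃ[ℝ] R41) (p : N) : Prop :=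
  ∃ lam : Plane → ℝ, ContDiff ℝ ∞ lam ∧ ∃ ψ : OpenPartialHomeomorph N Plane,
    p ∈ ψ.source ∧ ContMDiffOn (𝓡 2) (𝓡 2) ∞ ψ ψ.source ∧
    ContMDiffOn (𝓡 2) (𝓡 2) ∞ ψ.symm ψ.target ∧
    ∀ q ∈ ψ.source, Φ (f q) = nullGraph lam (ψ q)

end Surface

end MinkowskiSurface

end

/-! Scale the positive normal null vector so that its time coordinate is 1; call it `k`. By isotropy
the second fundamental form is a multiple of the null vector `k`, hence orthogonal to `k`.
Differentiating `⟨k, df Y⟩ = 0` then gives `⟨dk, df Y⟩ = 0`, and `⟨k, k⟩ = 0` and `k 0 = 1` show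
that `dk` is also orthogonal to `k` and purely spatial. This forces `dk = 0`, so `k` is constant on
the connected surface (`exists_normalNull`) and `f` lies in an affine hyperplane orthogonal to `k`
(`minkowski_const`).

A motion takes `k` to `u₀ + u₁` and the hyperplane to `x 0 = x 1`, where the metric degenerates to
the Euclidean one in the last two coordinates. Projection to these coordinates is thus a local
isometry of the surface into the plane (`preservesMetric_planeMap`), and its local inverses exhibit
the surface as a null graph. If the surface is complete, segments lift through this local isometry,
which is therefore bijective (`PreservesMetric.bijective`), and the graph is global. -/

namespace MinkowskiSurface

/-! ### Linear algebra of the normalized positive null vector. -/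

/-- The spatial determinant of three vectors of Minkowski space. -/
def spatialDet (k a c : R41) : ℝ :=
  k 1 * (a 2 * c 3 - a 3 * c 2) + k 2 * (a 3 * c 1 - a 1 * c 3) + k 3 * (a 1 * c 2 - a 2 * c 1)

/-- The Gram determinant of two vectors of Minkowski space. -/
def gram (a c : R41) : ℝ := minkowski a a * minkowski c c - minkowski a c ^ 2

/-- The squared length of the spatial cross product. -/
def crossSq (a c : R41) : ℝ :=
  (a 2 * c 3 - a 3 * c 2) ^ 2 + (a 3 * c 1 - a 1 * c 3) ^ 2 + (a 1 * c 2 - a 2 * c 1) ^ 2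

/-- `k` is the normalized positive null vector orthogonal to `a` and `c`. -/
structure IsPositiveNull (a c k : R41) : Prop where
  zero : k 0 = 1
  null : minkowski k k = 0
  left : minkowski k a = 0
  right : minkowski k c = 0
  pos : 0 < spatialDet k a c

/-- An explicit formula for the normalized positive null vector orthogonal to `a` and `c`. -/
noncomputable def nullDir (a c : R41) : R41 :=
  ![1,
    ((a 0 * c 2 - c 0 * a 2) * (a 1 * c 2 - a 2 * c 1)
      - (a 0 * c 3 - c 0 * a 3) * (a 3 * c 1 - a 1 * c 3)
      + √(gram a c) * (a 2 * c 3 - a 3 * c 2)) / crossSq a c,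
    ((a 0 * c 3 - c 0 * a 3) * (a 2 * c 3 - a 3 * c 2)
      - (a 0 * c 1 - c 0 * a 1) * (a 1 * c 2 - a 2 * c 1)
      + √(gram a c) * (a 3 * c 1 - a 1 * c 3)) / crossSq a c,
    ((a 0 * c 1 - c 0 * a 1) * (a 3 * c 1 - a 1 * c 3)
      - (a 0 * c 2 - c 0 * a 2) * (a 2 * c 3 - a 3 * c 2)
      + √(gram a c) * (a 1 * c 2 - a 2 * c 1)) / crossSq a c]

/-- Lagrange's identity in Lorentzian signature. It keeps the denominator of `nullDir` positive on
spacelike planes. -/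
lemma crossSq_eq (a c : R41) : crossSq a c = gram a c + (a 0 * c 1 - c 0 * a 1) ^ 2
    + (a 0 * c 2 - c 0 * a 2) ^ 2 + (a 0 * c 3 - c 0 * a 3) ^ 2 := by
  simp only [crossSq, gram, minkowski]; ring

lemma crossSq_pos {a c : R41} (h : 0 < gram a c) : 0 < crossSq a c := by
  rw [crossSq_eq]; positivity

/-- Let `n` be the spatial cross product of `a` and `c`, and `m` the spatial part of `a 0 • c - c 0
• a`. The spatial part of `nullDir` is `(m × n + √gram n) / |n|²`: the first term solves the two
orthogonality equations, the coefficient of `n` makes the vector null by `crossSq_eq`, and the sign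
of the root selects the positive line. -/
lemma isPositiveNull_nullDir {a c : R41} (h : 0 < gram a c) :
    IsPositiveNull a c (nullDir a c) := by
  have hn := crossSq_pos h
  have hn' := hn.ne'
  have hs : √(gram a c) ^ 2 = gram a c := Real.sq_sqrt h.le
  have hs0 : 0 < √(gram a c) := Real.sqrt_pos.2 h
  have e := crossSq_eq a c
  refine ⟨rfl, ?_, ?_, ?_, ?_⟩
  · simp only [minkowski, nullDir, Matrix.cons_val]
    rw [← hs] at e
    generalize √(gram a c) = s at *
    field_simp
    have : crossSq a c ^ 2 = crossSq a c * (s ^ 2 + (a 0 * c 1 - c 0 * a 1) ^ 2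
        + (a 0 * c 2 - c 0 * a 2) ^ 2 + (a 0 * c 3 - c 0 * a 3) ^ 2) := by rw [sq]; nth_rw 2 [e]
    rw [this]
    simp only [crossSq]
    ring
  · simp only [minkowski, nullDir, Matrix.cons_val]
    field_simp
    simp only [crossSq]
    ring
  · simp only [minkowski, nullDir, Matrix.cons_val]
    field_simp
    simp only [crossSq]
    ring
  · have : spatialDet (nullDir a c) a c = √(gram a c) := by
      simp only [spatialDet, nullDir, Matrix.cons_val]
      field_simp
      simp only [crossSq]
      ring
    rwa [this]

/-- Cramer's rule in the spatial coordinates; the multipliers are cofactors. It is used with `w` a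
derivative of `k`. -/
lemma eq_zero_of_orthogonal {a c k w : R41} (hd : spatialDet k a c ≠ 0) (h0 : w 0 = 0)
    (hk : minkowski w k = 0) (ha : minkowski w a = 0) (hc : minkowski w c = 0) : w = 0 := by
  simp only [minkowski, h0, zero_mul, neg_zero, zero_add] at hk ha hc
  have h1 : spatialDet k a c * w 1 = 0 := by
    simp only [spatialDet]
    linear_combination (a 2 * c 3 - a 3 * c 2) * hk + (c 2 * k 3 - c 3 * k 2) * ha
      + (k 2 * a 3 - k 3 * a 2) * hc
  have h2 : spatialDet k a c * w 2 = 0 := by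
    simp only [spatialDet]
    linear_combination (a 3 * c 1 - a 1 * c 3) * hk + (c 3 * k 1 - c 1 * k 3) * ha
      + (k 3 * a 1 - k 1 * a 3) * hc
  have h3 : spatialDet k a c * w 3 = 0 := by
    simp only [spatialDet]
    linear_combination (a 1 * c 2 - a 2 * c 1) * hk + (c 1 * k 2 - c 2 * k 1) * ha
      + (k 1 * a 2 - k 2 * a 1) * hc
  funext i
  fin_cases i
  · exact h0
  · exact (mul_eq_zero.1 h1).resolve_left hd
  · exact (mul_eq_zero.1 h2).resolve_left hd
  · exact (mul_eq_zero.1 h3).resolve_left hd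

lemma minkowski_comm (x y : R41) : minkowski x y = minkowski y x := by
  simp only [minkowski]; ring

/-- The difference `k - l` is spatial and orthogonal to `a`, `c` and `k + l`. Positivity of both
determinants keeps that of `k + l` from vanishing; without it the other normal null line would also
qualify. -/
lemma IsPositiveNull.unique {a c k l : R41} (hk : IsPositiveNull a c k)
    (hl : IsPositiveNull a c l) : k = l := by
  have h : spatialDet (k + l) a c = spatialDet k a c + spatialDet l a c := by
    simp only [spatialDet, Pi.add_apply]; ring
  have hne : spatialDet (k + l) a c ≠ 0 := by
    rw [h]; exact (add_pos hk.pos hl.pos).ne'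
  obtain ⟨k0, kk, ka, kc, -⟩ := hk
  obtain ⟨l0, ll, la, lc, -⟩ := hl
  refine sub_eq_zero.1 (eq_zero_of_orthogonal hne (by simp [k0, l0]) ?_ ?_ ?_) <;>
    simp only [minkowski, Pi.sub_apply, Pi.add_apply] at * <;> linarith

lemma contDiff_coord (i : Fin 4) : ContDiff ℝ ∞ (fun x : R41 => x i) := contDiff_apply ℝ ℝ i

lemma contDiffAt_nullDir {x : R41 × R41} (h : 0 < gram x.1 x.2) :
    ContDiffAt ℝ ∞ (fun y : R41 × R41 => nullDir y.1 y.2) x := by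
  have hg : ContDiff ℝ ∞ (fun y : R41 × R41 => gram y.1 y.2) := by
    unfold gram minkowski; fun_prop
  have hs : ContDiffAt ℝ ∞ (fun y : R41 × R41 => √(gram y.1 y.2)) x :=
    hg.contDiffAt.sqrt h.ne'
  have hn : ContDiff ℝ ∞ (fun y : R41 × R41 => crossSq y.1 y.2) := by
    unfold crossSq; fun_prop
  have hn' : crossSq x.1 x.2 ≠ 0 := (crossSq_pos h).ne'
  rw [contDiffAt_pi]
  intro i
  fin_cases i <;> simp only [nullDir, Fin.zero_eta, Fin.mk_one, Fin.reduceFinMk, Matrix.cons_val]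
  · exact contDiffAt_const
  all_goals
    refine ContDiffAt.div (ContDiffAt.add ?_ (ContDiffAt.mul hs ?_)) hn.contDiffAt hn' <;> fun_prop

/-- Minkowski product as a bilinear map. -/
noncomputable def minkowskiL : R41 →L[ℝ] R41 →L[ℝ] ℝ :=
  LinearMap.toContinuousLinearMap (LinearMap.toContinuousLinearMap.toLinearMap ∘ₗ
    LinearMap.mk₂ ℝ minkowski
      (by intros; simp only [minkowski, Pi.add_apply]; ring)
      (by intros; simp only [minkowski, Pi.smul_apply, smul_eq_mul]; ring)
      (by intros; simp only [minkowski, Pi.add_apply]; ring)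
      (by intros; simp only [minkowski, Pi.smul_apply, smul_eq_mul]; ring))

/-- The Darboux frame adapted to the normalized null vector `k` and tangent vectors `a`, `c`. -/
noncomputable def darboux (a c k : R41) : Fin 4 → R41 :=
  let μ := √(1 + a 0 ^ 2 + c 0 ^ 2)
  let e := μ⁻¹ • (Pi.single 0 1 + a 0 • a + c 0 • c)
  ![e, μ • k - e, a, c]

/-- The vector `u` below is the projection of `u₀` to the normal plane, with `⟨u, u⟩ = -μ²` and `⟨u,
k⟩ = -1`. So `e = u / μ` is unit timelike, and `μ k - e` is the unit normal completing it. -/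
lemma darboux_orthonormal {a c k : R41} (h : IsPositiveNull a c k) (haa : minkowski a a = 1)
    (hcc : minkowski c c = 1) (hac : minkowski a c = 0) (i j : Fin 4) :
    minkowski (darboux a c k i) (darboux a c k j)
      = if i = j then (if i = 0 then -1 else 1) else 0 := by
  obtain ⟨k0, kk, ka, kc, -⟩ := h
  have hp : 0 < 1 + a 0 ^ 2 + c 0 ^ 2 := by positivity
  have hμ : 0 < √(1 + a 0 ^ 2 + c 0 ^ 2) := Real.sqrt_pos.2 hp
  have hμ2 : √(1 + a 0 ^ 2 + c 0 ^ 2) ^ 2 = 1 + a 0 ^ 2 + c 0 ^ 2 := Real.sq_sqrt hp.le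
  simp only [darboux]
  generalize √(1 + a 0 ^ 2 + c 0 ^ 2) = μ at *
  set u : R41 := Pi.single 0 1 + a 0 • a + c 0 • c with hu
  have u0 : u 0 = 1 + a 0 * a 0 + c 0 * c 0 := by simp [hu]
  have u1 : u 1 = a 0 * a 1 + c 0 * c 1 := by simp [hu]
  have u2 : u 2 = a 0 * a 2 + c 0 * c 2 := by simp [hu]
  have u3 : u 3 = a 0 * a 3 + c 0 * c 3 := by simp [hu]
  have uu : minkowski u u = -μ ^ 2 := by
    rw [hμ2]
    simp only [minkowski, u0, u1, u2, u3] at *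
    linear_combination a 0 ^ 2 * haa + c 0 ^ 2 * hcc + 2 * a 0 * c 0 * hac
  have uk : minkowski u k = -1 := by
    simp only [minkowski, u0, u1, u2, u3] at *
    linear_combination a 0 * ka + c 0 * kc - k0
  have ua : minkowski u a = 0 := by
    simp only [minkowski, u0, u1, u2, u3] at *
    linear_combination a 0 * haa + c 0 * hac
  have uc : minkowski u c = 0 := by
    simp only [minkowski, u0, u1, u2, u3] at *
    linear_combination a 0 * hac + c 0 * hcc
  clear_value u
  have hi : μ⁻¹ * μ = 1 := inv_mul_cancel₀ hμ.ne'
  generalize μ⁻¹ = ν at *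
  have A : ∀ x y z : R41, minkowski (x - y) z = minkowski x z - minkowski y z := by
    intros; simp only [minkowski, Pi.sub_apply]; ring
  have A' : ∀ x y z : R41, minkowski z (x - y) = minkowski z x - minkowski z y := by
    intros; simp only [minkowski, Pi.sub_apply]; ring
  have B : ∀ (t : ℝ) (x y : R41), minkowski (t • x) y = t * minkowski x y := by
    intros; simp only [minkowski, Pi.smul_apply, smul_eq_mul]; ring
  have B' : ∀ (t : ℝ) (x y : R41), minkowski x (t • y) = t * minkowski x y := by
    intros; simp only [minkowski, Pi.smul_apply, smul_eq_mul]; ring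
  have ak := (minkowski_comm a k).trans ka
  have ck := (minkowski_comm c k).trans kc
  have ku := (minkowski_comm k u).trans uk
  have au := (minkowski_comm a u).trans ua
  have cu := (minkowski_comm c u).trans uc
  have ca := (minkowski_comm c a).trans hac
  have h2 : ν ^ 2 * μ ^ 2 = 1 := by linear_combination (ν * μ + 1) * hi
  fin_cases i <;> fin_cases j <;>
    simp [A, A', B, B', haa, hcc, hac, kk, ka, kc, uu, uk, ua, uc, ak, ck, ku, au, cu, ca] <;>
    linarith

lemma darboux_det_pos {a c k : R41} (h : IsPositiveNull a c k) :
    0 < (Matrix.of (darboux a c k)).det := by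
  have hp : 0 < 1 + a 0 ^ 2 + c 0 ^ 2 := by positivity
  have hμ : 0 < √(1 + a 0 ^ 2 + c 0 ^ 2) := Real.sqrt_pos.2 hp
  suffices (Matrix.of (darboux a c k)).det = spatialDet k a c by rw [this]; exact h.pos
  simp only [darboux]
  generalize √(1 + a 0 ^ 2 + c 0 ^ 2) = μ at *
  have hi : μ⁻¹ * μ = 1 := inv_mul_cancel₀ hμ.ne'
  generalize μ⁻¹ = ν at *
  rw [Matrix.det_succ_row_zero]
  simp [Fin.sum_univ_four, Matrix.det_fin_three, Fin.succAbove, spatialDet, Pi.single_apply]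
  linear_combination (k 1 * (a 2 * c 3 - a 3 * c 2) + k 2 * (a 3 * c 1 - a 1 * c 3)
    + k 3 * (a 1 * c 2 - a 2 * c 1)) * hi

lemma darboux_add (a c k : R41) :
    darboux a c k 0 + darboux a c k 1 = √(1 + a 0 ^ 2 + c 0 ^ 2) • k := by
  simp [darboux]

lemma spatialDet_comb (k a c : R41) (p q r s : ℝ) :
    spatialDet k (p • a + q • c) (r • a + s • c) = (p * s - q * r) * spatialDet k a c := by
  simp only [spatialDet, Pi.add_apply, Pi.smul_apply, smul_eq_mul]; ring

/-! ### Vanishing differentials and the inverse function theorem on manifolds. -/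

section Manifold

variable {E : Type*} [NormedAddCommGroup E] [NormedSpace ℝ E]
  {F : Type*} [NormedAddCommGroup F] [NormedSpace ℝ F]
  {M : Type*} [TopologicalSpace M] [ChartedSpace E M]

/-- A function with vanishing differential on an open set is locally constant there. -/
lemma exists_eq_of_mfderiv_eq_zero [IsManifold 𝓘(ℝ, E) 1 M] {U : Set M} (hU : IsOpen U)
    {f : M → F} (hf : ∀ q ∈ U, MDifferentiableAt 𝓘(ℝ, E) 𝓘(ℝ, F) f q)
    (h0 : ∀ q ∈ U, mfderiv 𝓘(ℝ, E) 𝓘(ℝ, F) f q = 0) {p : M} (hp : p ∈ U) :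
    ∃ V : Set M, IsOpen V ∧ p ∈ V ∧ V ⊆ U ∧ ∀ q ∈ V, f q = f p := by
  set φ := chartAt E p
  have hpφ : p ∈ φ.source := mem_chart_source E p
  have hO : IsOpen (φ.target ∩ φ.symm ⁻¹' U) := φ.isOpen_inter_preimage_symm hU
  have hmem : φ p ∈ φ.target ∩ φ.symm ⁻¹' U :=
    ⟨φ.map_source hpφ, by simpa [φ.left_inv hpφ] using hp⟩
  obtain ⟨r, hr, hball⟩ := Metric.isOpen_iff.1 hO _ hmem
  have key : ∀ y ∈ Metric.ball (φ p) r, HasFDerivAt (f ∘ φ.symm) (0 : E →L[ℝ] F) y := by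
    intro y hy
    have hyt := (hball hy).1
    have hyU := (hball hy).2
    have hs : MDifferentiableAt 𝓘(ℝ, E) 𝓘(ℝ, E) φ.symm y :=
      mdifferentiableAt_atlas_symm (chart_mem_atlas E p) hyt
    have := (hf _ hyU).hasMFDerivAt.comp y hs.hasMFDerivAt
    rw [h0 _ hyU] at this
    have h2 := this.hasFDerivAt
    exact h2
  refine ⟨φ.source ∩ φ ⁻¹' (Metric.ball (φ p) r), φ.isOpen_inter_preimage Metric.isOpen_ball,
    ⟨hpφ, Metric.mem_ball_self hr⟩, fun q hq => ?_, fun q hq => ?_⟩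
  · have := (hball hq.2).2
    rwa [Set.mem_preimage, φ.left_inv hq.1] at this
  · have := (convex_ball (φ p) r).is_const_of_fderivWithin_eq_zero (𝕜 := ℝ) (f := f ∘ φ.symm)
      (fun y hy => (key y hy).differentiableAt.differentiableWithinAt)
      (fun y hy => by
        rw [fderivWithin_of_isOpen Metric.isOpen_ball hy, (key y hy).fderiv])
      hq.2 (Metric.mem_ball_self hr)
    simpa [φ.left_inv hq.1, φ.left_inv hpφ] using this

/-- A function with vanishing differential on a connected manifold is constant. -/
lemma eq_of_mfderiv_eq_zero [IsManifold 𝓘(ℝ, E) 1 M] [PreconnectedSpace M]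
    {f : M → F} (hf : MDifferentiable 𝓘(ℝ, E) 𝓘(ℝ, F) f)
    (h0 : ∀ q, mfderiv 𝓘(ℝ, E) 𝓘(ℝ, F) f q = 0) (p q : M) : f p = f q := by
  have : IsLocallyConstant f := (IsLocallyConstant.iff_exists_open f).2 fun x => by
    obtain ⟨V, hV, hx, -, h⟩ := exists_eq_of_mfderiv_eq_zero isOpen_univ (fun q _ => hf q)
      (fun q _ => h0 q) (Set.mem_univ x)
    exact ⟨V, hV, hx, h⟩
  exact this.apply_eq_of_preconnectedSpace p q

/-- The inverse function theorem: a smooth map with everywhere invertible differential is a local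
diffeomorphism. -/
lemma isLocalDiffeomorph_of_mfderiv [CompleteSpace E] [IsManifold 𝓘(ℝ, E) ∞ M] {f : M → F}
    (hf : ContMDiff 𝓘(ℝ, E) 𝓘(ℝ, F) ∞ f)
    (h : ∀ q, ∃ e : E ≃L[ℝ] F, (e : E →L[ℝ] F) = mfderiv 𝓘(ℝ, E) 𝓘(ℝ, F) f q) :
    IsLocalDiffeomorph 𝓘(ℝ, E) 𝓘(ℝ, F) ∞ f := by
  have : IsManifold 𝓘(ℝ, E) 1 M := IsManifold.of_le (n := ∞) (by simp)
  intro p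
  set φ := chartAt E p
  have hpφ : p ∈ φ.source := mem_chart_source E p
  have hsm : ContMDiffOn 𝓘(ℝ, E) 𝓘(ℝ, E) ∞ φ φ.source := contMDiffOn_chart
  have hsm' : ContMDiffOn 𝓘(ℝ, E) 𝓘(ℝ, E) ∞ φ.symm φ.target := contMDiffOn_chart_symm
  have hcd : ∀ y ∈ φ.target, ContDiffAt ℝ ∞ (f ∘ φ.symm) y := fun y hy =>
    ((hf _).comp y (hsm'.contMDiffAt (φ.open_target.mem_nhds hy))).contDiffAt
  have hder : ∀ y ∈ φ.target, ∃ e : E ≃L[ℝ] F, HasFDerivAt (f ∘ φ.symm) (e : E →L[ℝ] F) y := by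
    intro y hy
    have hs : MDifferentiableAt 𝓘(ℝ, E) 𝓘(ℝ, E) φ.symm y :=
      mdifferentiableAt_atlas_symm (chart_mem_atlas E p) hy
    have h1 : MDifferentiableAt 𝓘(ℝ, E) 𝓘(ℝ, F) f (φ.symm y) :=
      (hf _).mdifferentiableAt (by simp)
    have h3 := (h1.hasMFDerivAt.comp y hs.hasMFDerivAt).hasFDerivAt
    obtain ⟨e, he⟩ := h (φ.symm y)
    obtain ⟨e', he'⟩ : ∃ e' : E ≃L[ℝ] E,
        (e' : E →L[ℝ] E) = mfderiv 𝓘(ℝ, E) 𝓘(ℝ, E) φ.symm y :=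
      ⟨(mdifferentiable_chart (I := 𝓘(ℝ, E)) p).symm.mfderiv hy, rfl⟩
    refine ⟨e'.trans e, ?_⟩
    have : ((e'.trans e : E ≃L[ℝ] F) : E →L[ℝ] F) = (e : E →L[ℝ] F).comp (e' : E →L[ℝ] E) := rfl
    rw [this, he, he']
    exact h3
  obtain ⟨e₀, he₀⟩ := hder (φ p) (φ.map_source hpφ)
  set g := (hcd (φ p) (φ.map_source hpφ)).toOpenPartialHomeomorph (f ∘ φ.symm) he₀ (by simp)
  have hgc : ∀ y, g y = f (φ.symm y) := fun y => rfl
  set ψ := φ.trans g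
  have hψs : ∀ q ∈ ψ.source, f q = ψ q := fun q hq => by
    have : q ∈ φ.source := by simp [ψ] at hq; exact hq.1
    simp [ψ, hgc, φ.left_inv this]
  have hpψ : p ∈ ψ.source := by
    simp only [ψ, OpenPartialHomeomorph.trans_source]
    exact ⟨hpφ, ContDiffAt.mem_toOpenPartialHomeomorph_source
      (hcd (φ p) (φ.map_source hpφ)) he₀ (by simp)⟩
  refine ⟨⟨ψ.toPartialEquiv, ψ.open_source, ψ.open_target,
    (hf.contMDiffOn).congr fun q hq => (hψs q hq).symm, ?_⟩, hpψ, hψs⟩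
  intro y hy
  have hy1 : y ∈ g.target := by simp [ψ] at hy; exact hy.1
  have hy2 : g.symm y ∈ φ.target := by simp [ψ] at hy; exact hy.2
  -- The differential is invertible at every point of the chart, not only at `p`, so the inverse is
  -- smooth on its whole domain.
  obtain ⟨e, he⟩ := hder _ hy2
  have h1 : ContDiffAt ℝ ∞ g.symm y := g.contDiffAt_symm hy1 he (hcd _ hy2)
  have h2 := (hsm'.contMDiffAt (φ.open_target.mem_nhds hy2)).comp y h1.contMDiffAt
  exact h2.contMDiffWithinAt

end Manifold

/-! ### The positive normal null direction is constant. -/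

section Surface

variable {N : Type*} [TopologicalSpace N] [ChartedSpace Plane N]

/-- Product rule for a constant Minkowski product. -/
lemma minkowski_differential_add {x y : N → R41} {p : N} {C : ℝ}
    (hx : MDifferentiableAt (𝓡 2) 𝓘(ℝ, R41) x p) (hy : MDifferentiableAt (𝓡 2) 𝓘(ℝ, R41) y p)
    (h : ∀ᶠ q in nhds p, minkowski (x q) (y q) = C) (v : TangentSpace (𝓡 2) p) :
    minkowski (differential x p v) (y p) + minkowski (x p) (differential y p v) = 0 := by
  obtain ⟨D, hD⟩ : ∃ D : TangentSpace (𝓡 2) p →L[ℝ] R41 × R41,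
      HasMFDerivAt (𝓡 2) 𝓘(ℝ, R41 × R41) (fun q => (x q, y q)) p D :=
    ⟨_, (hx.prodMk_space hy).hasMFDerivAt⟩
  have hx' : differential x p v = (D v).1 :=
    DFunLike.congr_fun (HasMFDerivAt.mfderiv (HasMFDerivAt.comp p
      (hasFDerivAt_fst (𝕜 := ℝ) (E := R41) (F := R41)).hasMFDerivAt hD)) v
  have hy' : differential y p v = (D v).2 :=
    DFunLike.congr_fun (HasMFDerivAt.mfderiv (HasMFDerivAt.comp p
      (hasFDerivAt_snd (𝕜 := ℝ) (E := R41) (F := R41)).hasMFDerivAt hD)) v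
  obtain ⟨B, hB, hBv⟩ : ∃ B : R41 × R41 →L[ℝ] ℝ,
      HasFDerivAt (fun z : R41 × R41 => minkowski z.1 z.2) B (x p, y p) ∧
        ∀ w, B w = minkowski (x p) w.2 + minkowski w.1 (y p) :=
    ⟨_, minkowskiL.hasFDerivAt_of_bilinear (f := fun z : R41 × R41 => z.1)
      (g := fun z : R41 × R41 => z.2) (x := (x p, y p)) hasFDerivAt_fst hasFDerivAt_snd,
      fun w => rfl⟩
  have h3 : HasMFDerivAt (𝓡 2) 𝓘(ℝ, ℝ) (fun q => minkowski (x q) (y q)) p (B.comp D) :=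
    HasMFDerivAt.comp p hB.hasMFDerivAt hD
  have h4 : HasMFDerivAt (𝓡 2) 𝓘(ℝ, ℝ) (fun _ : N => C) p 0 := hasMFDerivAt_const C p
  have h5 := h3.congr_of_eventuallyEq (f₁ := fun _ : N => C) (by
    filter_upwards [h] with q hq
    exact hq.symm)
  have h7 : B (D v) = 0 := DFunLike.congr_fun (hasMFDerivAt_unique h5 h4) v
  rw [hBv] at h7
  rw [hx', hy', add_comm]
  exact h7

/-- `k` is the normalized vector of the positive normal null line of `f` at `p`. -/
structure IsNormalNull (o : (p : N) → Orientation ℝ (TangentSpace (𝓡 2) p) (Fin 2))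
    (f : N → R41) (p : N) (k : R41) : Prop where
  zero : k 0 = 1
  null : minkowski k k = 0
  normal : ∀ v, minkowski k (differential f p v) = 0
  pos : ∀ b : Module.Basis (Fin 2) ℝ (TangentSpace (𝓡 2) p), b.orientation = o p →
    0 < spatialDet k (differential f p (b 0)) (differential f p (b 1))

lemma minkowski_smul_right (t : ℝ) (x y : R41) : minkowski x (t • y) = t * minkowski x y :=
  (minkowskiL x).map_smul t y

lemma minkowski_smul_left (t : ℝ) (x y : R41) : minkowski (t • x) y = t * minkowski x y := by
  rw [minkowski_comm, minkowski_smul_right, minkowski_comm]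

lemma minkowski_add_right (x y z : R41) : minkowski x (y + z) = minkowski x y + minkowski x z :=
  (minkowskiL x).map_add y z

lemma minkowski_sub_right (x y z : R41) : minkowski x (y - z) = minkowski x y - minkowski x z :=
  (minkowskiL x).map_sub y z

lemma minkowski_sum_right {ι : Type*} (s : Finset ι) (x : R41) (y : ι → R41) :
    minkowski x (∑ i ∈ s, y i) = ∑ i ∈ s, minkowski x (y i) :=
  map_sum (minkowskiL x) y s

lemma IsNormalNull.isPositiveNull {o : (p : N) → Orientation ℝ (TangentSpace (𝓡 2) p) (Fin 2)}
    {f : N → R41} {p : N} {k : R41} (h : IsNormalNull o f p k)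
    {b : Module.Basis (Fin 2) ℝ (TangentSpace (𝓡 2) p)} (hb : b.orientation = o p) :
    IsPositiveNull (differential f p (b 0)) (differential f p (b 1)) k :=
  ⟨h.zero, h.null, h.normal _, h.normal _, h.pos b hb⟩

/-- A change of tangent basis multiplies `spatialDet` by its determinant, which is positive when the
orientations agree; one basis therefore suffices. -/
lemma IsPositiveNull.isNormalNull {o : (p : N) → Orientation ℝ (TangentSpace (𝓡 2) p) (Fin 2)}
    {f : N → R41} {p : N} {k : R41} {b : Module.Basis (Fin 2) ℝ (TangentSpace (𝓡 2) p)}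
    (hb : b.orientation = o p)
    (h : IsPositiveNull (differential f p (b 0)) (differential f p (b 1)) k) :
    IsNormalNull o f p k := by
  refine ⟨h.zero, h.null, fun v => ?_, fun b' hb' => ?_⟩
  · rw [← b.sum_repr v, Fin.sum_univ_two, map_add, map_smul, map_smul, minkowski_add_right,
      minkowski_smul_right, minkowski_smul_right, h.left, h.right]
    simp
  · have hdet : 0 < b.det b' := (b.orientation_eq_iff_det_pos b').1 (hb.trans hb'.symm)
    have e : ∀ i, differential f p (b' i) = b.repr (b' i) 0 • differential f p (b 0)
        + b.repr (b' i) 1 • differential f p (b 1) := fun i => by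
      conv_lhs => rw [← b.sum_repr (b' i), Fin.sum_univ_two, map_add, map_smul, map_smul]
    rw [e 0, e 1, spatialDet_comb]
    refine mul_pos ?_ h.pos
    rw [Module.Basis.det_apply, Matrix.det_fin_two] at hdet
    simp only [Module.Basis.toMatrix_apply] at hdet
    linarith

lemma IsNormalNull.unique {o : (p : N) → Orientation ℝ (TangentSpace (𝓡 2) p) (Fin 2)}
    {f : N → R41} {p : N} {k l : R41} {b : Module.Basis (Fin 2) ℝ (TangentSpace (𝓡 2) p)}
    (hb : b.orientation = o p) (hk : IsNormalNull o f p k) (hl : IsNormalNull o f p l) : k = l :=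
  (hk.isPositiveNull hb).unique (hl.isPositiveNull hb)

lemma contMDiffOn_differential [IsManifold (𝓡 2) ∞ N] {f : N → R41} (hf : ContMDiff (𝓡 2) 𝓘(ℝ, R41) ∞ f) {U : Set N}
    {Y : (q : N) → TangentSpace (𝓡 2) q} (hY : IsSmoothFieldOn U Y) :
    ContMDiffOn (𝓡 2) 𝓘(ℝ, R41) ∞ (fun q => differential f q (Y q)) U :=
  (contMDiff_snd_tangentBundle_modelSpace R41 𝓘(ℝ, R41)).comp_contMDiffOn
    ((hf.contMDiff_tangentMap (m := ∞) (by simp)).comp_contMDiffOn hY)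

variable [RiemannianBundle (fun p : N => TangentSpace (𝓡 2) p)]

/-- Gram–Schmidt: the Gram determinant is the squared length of `b 0` times that of the part of `b
1` orthogonal to `b 0`. -/
lemma gram_pos {f : N → R41} (hf : IsIsometricImmersion f) {p : N}
    (b : Module.Basis (Fin 2) ℝ (TangentSpace (𝓡 2) p)) :
    0 < gram (differential f p (b 0)) (differential f p (b 1)) := by
  have h0 : b 0 ≠ 0 := b.ne_zero 0
  have key : b 1 - (inner ℝ (b 0) (b 1) / inner ℝ (b 0) (b 0) : ℝ) • b 0 ≠ 0 := by
    intro h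
    have := congrArg (fun v => b.repr v 1) h
    simp at this
  have hp0 : (0 : ℝ) < inner ℝ (b 0) (b 0) := real_inner_self_pos.2 h0
  have hp1 := real_inner_self_pos.2 key
  simp only [gram, hf.isometric]
  simp only [inner_sub_left, inner_sub_right, inner_smul_left, inner_smul_right,
    real_inner_comm (b 0) (b 1), RCLike.conj_to_real] at hp1
  have e : (inner ℝ (b 0) (b 0) : ℝ) * inner ℝ (b 1) (b 1) - inner ℝ (b 0) (b 1) ^ 2
      = inner ℝ (b 0) (b 0) * ((inner ℝ (b 1) (b 1) : ℝ) - inner ℝ (b 0) (b 1) ^ 2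
        / inner ℝ (b 0) (b 0)) := by field_simp
  rw [e]
  refine mul_pos hp0 (hp1.trans_eq ?_)
  field_simp
  ring

lemma minkowski_normalPart {f : N → R41} {p : N} {k : R41}
    (hk : ∀ v, minkowski k (differential f p v) = 0) (v : R41) :
    minkowski k (normalPart f p v) = minkowski k v := by
  simp only [normalPart, minkowski_sub_right, minkowski_sum_right, minkowski_smul_right, hk]
  simp

/-- Isotropy speaks only through Darboux frames; a frame whose null line is spanned by `k` makes it
a statement about `k`. -/
lemma exists_darboux {o : (p : N) → Orientation ℝ (TangentSpace (𝓡 2) p) (Fin 2)} {f : N → R41}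
    (hf : IsIsometricImmersion f) {p : N} {k : R41} (hk : IsNormalNull o f p k) :
    ∃ e, IsDarbouxFrame o f p e ∧ e 0 + e 1 ∈ Submodule.span ℝ {k} := by
  have hfin : Module.finrank ℝ (TangentSpace (𝓡 2) p) = 2 :=
    (finrank_euclideanSpace_fin : Module.finrank ℝ Plane = 2)
  set b := (o p).finOrthonormalBasis two_pos hfin with hbdef
  have hb : b.toBasis.orientation = o p := (o p).finOrthonormalBasis_orientation two_pos hfin
  have hpn := hk.isPositiveNull hb
  simp only [OrthonormalBasis.coe_toBasis] at hpn
  refine ⟨darboux (differential f p (b 0)) (differential f p (b 1)) k,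
    ⟨darboux_orthonormal hpn ?_ ?_ ?_, darboux_det_pos hpn, b.toBasis, hb, ?_, ?_⟩, ?_⟩
  · rw [hf.isometric, b.inner_eq_ite]; simp
  · rw [hf.isometric, b.inner_eq_ite]; simp
  · rw [hf.isometric, b.inner_eq_ite]; simp
  · rw [OrthonormalBasis.coe_toBasis]; rfl
  · rw [OrthonormalBasis.coe_toBasis]; rfl
  · rw [darboux_add]
    exact Submodule.smul_mem _ _ (Submodule.mem_span_singleton_self k)

variable [IsManifold (𝓡 2) ∞ N]

/-- The tangential part of the derivative is orthogonal to `k`, and its normal part is a multiple of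
`k`, which is null. -/
lemma minkowski_second_derivative_eq_zero
    {o : (p : N) → Orientation ℝ (TangentSpace (𝓡 2) p) (Fin 2)} {f : N → R41}
    (hf : IsIsometricImmersion f) (hiso : IsPlusIsotropic o f) {U : Set N} (hU : IsOpen U)
    {X Y : (q : N) → TangentSpace (𝓡 2) q} (hX : IsSmoothFieldOn U X) (hY : IsSmoothFieldOn U Y)
    {p : N} (hp : p ∈ U) {k : R41} (hk : IsNormalNull o f p k) :
    minkowski k (differential (fun q => differential f q (Y q)) p (X p)) = 0 := by
  obtain ⟨e, he, hek⟩ := exists_darboux hf hk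
  have h := hiso U hU X Y hX hY p hp e he
  obtain ⟨s, hs⟩ := Submodule.mem_span_singleton.1 hek
  obtain ⟨t, ht⟩ := Submodule.mem_span_singleton.1 h
  rw [← minkowski_normalPart hk.normal]
  change minkowski k (secondFundamentalForm f X Y p) = 0
  rw [← ht, ← hs, minkowski_smul_right, minkowski_smul_right, hk.null]
  simp

lemma exists_local_normalNull {o : (p : N) → Orientation ℝ (TangentSpace (𝓡 2) p) (Fin 2)}
    (ho : IsSurfaceOrientation o) {f : N → R41} (hf : IsIsometricImmersion f)
    (hiso : IsPlusIsotropic o f) (p : N) :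
    ∃ V : Set N, IsOpen V ∧ p ∈ V ∧ ∃ k, ∀ q ∈ V, IsNormalNull o f q k := by
  have : IsManifold (𝓡 2) 1 N := IsManifold.of_le (n := ∞) (by simp)
  obtain ⟨U, hU, hp, b, hb, hbo⟩ := ho p
  set a : Fin 2 → N → R41 := fun i q => differential f q (b q i) with ha
  set k : N → R41 := fun q => nullDir (a 0 q) (a 1 q) with hk
  have has : ∀ i, ContMDiffOn (𝓡 2) 𝓘(ℝ, R41) ∞ (a i) U := fun i =>
    contMDiffOn_differential hf.smooth (hb i)
  have had : ∀ i, ∀ q ∈ U, MDifferentiableAt (𝓡 2) 𝓘(ℝ, R41) (a i) q := fun i q hq =>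
    ((has i).contMDiffAt (hU.mem_nhds hq)).mdifferentiableAt (by simp)
  have hpn : ∀ q ∈ U, IsPositiveNull (a 0 q) (a 1 q) (k q) := fun q _ =>
    isPositiveNull_nullDir (gram_pos hf (b q))
  have hkn : ∀ q ∈ U, IsNormalNull o f q (k q) := fun q hq => (hpn q hq).isNormalNull (hbo q hq)
  have hkd : ∀ q ∈ U, MDifferentiableAt (𝓡 2) 𝓘(ℝ, R41) k q := fun q hq => by
    have h1 : MDifferentiableAt (𝓡 2) 𝓘(ℝ, R41 × R41) (fun q => (a 0 q, a 1 q)) q :=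
      (had 0 q hq).prodMk_space (had 1 q hq)
    have h2 : MDifferentiableAt 𝓘(ℝ, R41 × R41) 𝓘(ℝ, R41) (fun y : R41 × R41 => nullDir y.1 y.2)
        (a 0 q, a 1 q) :=
      ((contDiffAt_nullDir (gram_pos hf (b q))).differentiableAt (by simp)).mdifferentiableAt
    exact MDifferentiableAt.comp (g := fun y : R41 × R41 => nullDir y.1 y.2)
      (f := fun q => (a 0 q, a 1 q)) q h2 h1
  have hev : ∀ q ∈ U, ∀ P : N → Prop, (∀ q ∈ U, P q) → ∀ᶠ q in nhds q, P q := fun q hq P hP =>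
    Filter.mem_of_superset (hU.mem_nhds hq) hP
  -- Differentiating `⟨k, a i⟩ = 0`, `⟨k, u₀⟩ = -1` and `⟨k, k⟩ = 0` supplies the hypotheses of
  -- `eq_zero_of_orthogonal`.
  have hk0 : ∀ q ∈ U, mfderiv (𝓡 2) 𝓘(ℝ, R41) k q = 0 := by
    intro q hq
    have main : ∀ j, differential k q (b q j) = 0 := by
      intro j
      have hka : ∀ i, minkowski (differential k q (b q j)) (a i q) = 0 := by
        intro i
        have h1 := minkowski_differential_add (C := 0) (hkd q hq) (had i q hq)
          (hev q hq _ fun q hq => (hkn q hq).normal _) (b q j)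
        have h2 : minkowski (k q) (differential (a i) q (b q j)) = 0 :=
          minkowski_second_derivative_eq_zero (X := fun q => b q j) (Y := fun q => b q i)
            hf hiso hU (hb j) (hb i) hq (hkn q hq)
        linarith
      refine eq_zero_of_orthogonal (hpn q hq).pos.ne' ?_ ?_ (hka 0) (hka 1)
      · have h1 := minkowski_differential_add (x := k) (y := fun _ => (Pi.single 0 1 : R41))
          (C := -1) (hkd q hq) mdifferentiableAt_const
          (hev q hq _ fun q hq => by simp [minkowski, (hkn q hq).zero]) (b q j)
        have h2 : differential (fun _ : N => (Pi.single 0 1 : R41)) q = 0 := mfderiv_const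
        rw [h2] at h1
        simpa [minkowski] using h1
      · have h1 := minkowski_differential_add (C := 0) (hkd q hq) (hkd q hq)
          (hev q hq _ fun q hq => (hkn q hq).null) (b q j)
        rw [minkowski_comm (k q)] at h1
        linarith
    have : (differential k q : TangentSpace (𝓡 2) q →ₗ[ℝ] R41) = 0 :=
      (b q).ext fun j => main j
    exact ContinuousLinearMap.coe_injective this
  obtain ⟨V, hV, hpV, hVU, hVk⟩ := exists_eq_of_mfderiv_eq_zero hU hkd hk0 hp
  exact ⟨V, hV, hpV, k p, fun q hq => hVk q hq ▸ hkn q (hVU hq)⟩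

/-- The normalized vector of the positive normal null line is constant. -/
lemma exists_normalNull [ConnectedSpace N]
    {o : (p : N) → Orientation ℝ (TangentSpace (𝓡 2) p) (Fin 2)}
    (ho : IsSurfaceOrientation o) {f : N → R41} (hf : IsIsometricImmersion f)
    (hiso : IsPlusIsotropic o f) : ∃ k, ∀ q, IsNormalNull o f q k := by
  have huniq : ∀ q k l, IsNormalNull o f q k → IsNormalNull o f q l → k = l := fun q k l hk hl => by
    obtain ⟨U, -, hq, b, -, hb⟩ := ho q
    exact hk.unique (hb q hq) hl
  obtain ⟨p⟩ : Nonempty N := inferInstance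
  obtain ⟨V, -, hpV, k, hk⟩ := exists_local_normalNull ho hf hiso p
  refine ⟨k, fun q => ?_⟩
  -- Near each point one fixed vector serves. By uniqueness it equals `k` if `k` serves at any point
  -- there, so the set and its complement are both open.
  have hclopen : IsClopen {q | IsNormalNull o f q k} := by
    refine ⟨⟨isOpen_iff_mem_nhds.2 fun q hq => ?_⟩, isOpen_iff_mem_nhds.2 fun q hq => ?_⟩
    all_goals
      obtain ⟨W, hW, hqW, l, hl⟩ := exists_local_normalNull ho hf hiso q
      refine Filter.mem_of_superset (hW.mem_nhds hqW) fun r hr => ?_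
    · intro hrk
      have hkl := huniq r k l hrk (hl r hr)
      exact hq (hkl ▸ hl q hqW)
    · have hkl := huniq q k l hq (hl q hqW)
      exact hkl ▸ hl r hr
  have := hclopen.eq_univ ⟨p, hk p hpV⟩
  exact Set.eq_univ_iff_forall.1 this q

end Surface

/-! ### Local isometries of a complete surface into the plane. -/

section LocalIsometry

variable {N : Type*} [MetricSpace N] [ChartedSpace Plane N]
  [RiemannianBundle (fun p : N => TangentSpace (𝓡 2) p)]

/-- A map into the Euclidean plane whose differential preserves the Riemannian metric. -/
def PreservesMetric (φ : N → Plane) : Prop :=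
  ∀ (p : N) (v w : TangentSpace (𝓡 2) p),
    inner ℝ (mfderiv (𝓡 2) (𝓡 2) φ p v : Plane) (mfderiv (𝓡 2) (𝓡 2) φ p w : Plane) = inner ℝ v w

lemma PreservesMetric.norm_eq {φ : N → Plane} (h : PreservesMetric φ) {p : N}
    {v : TangentSpace (𝓡 2) p} {w : Plane} (hw : mfderiv (𝓡 2) (𝓡 2) φ p v = w) :
    ‖w‖ = ‖v‖ := by
  have h1 : (inner ℝ w w : ℝ) = inner ℝ v v := by
    rw [← hw]
    exact h p v v
  rw [real_inner_self_eq_norm_sq, real_inner_self_eq_norm_sq] at h1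
  exact (sq_eq_sq₀ (norm_nonneg _) (norm_nonneg _)).1 h1

variable [IsManifold (𝓡 2) ∞ N]

/-- A norm-preserving differential is injective, hence invertible since the dimensions agree. -/
lemma PreservesMetric.isLocalDiffeomorph {φ : N → Plane} (h : PreservesMetric φ)
    (hφ : ContMDiff (𝓡 2) (𝓡 2) ∞ φ) : IsLocalDiffeomorph (𝓡 2) (𝓡 2) ∞ φ := by
  refine isLocalDiffeomorph_of_mfderiv hφ fun q => ?_
  have hinj : ∀ v : TangentSpace (𝓡 2) q, mfderiv (𝓡 2) (𝓡 2) φ q v = 0 → v = 0 := by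
    intro v hv
    have h1 := h.norm_eq (w := 0) hv
    rw [norm_zero] at h1
    exact norm_eq_zero.1 h1.symm
  obtain ⟨A, hA⟩ : ∃ A : Plane →L[ℝ] Plane, A = mfderiv (𝓡 2) (𝓡 2) φ q := ⟨_, rfl⟩
  have hAinj : Function.Injective (A : Plane →ₗ[ℝ] Plane) := by
    rw [injective_iff_map_eq_zero]
    intro v hv
    exact hinj v (by rw [← hA]; exact hv)
  refine ⟨(LinearEquiv.ofInjectiveEndo (A : Plane →ₗ[ℝ] Plane) hAinj).toContinuousLinearEquiv, ?_⟩
  rw [← hA]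
  ext v : 1
  rfl

variable [IsRiemannianManifold (𝓡 2) N]

/-- A lift of a segment through a local isometry is no longer than the segment. -/
lemma PreservesMetric.edist_lift_le {φ : N → Plane} (h : PreservesMetric φ)
    (hφ : ContMDiff (𝓡 2) (𝓡 2) ∞ φ) {γ : ℝ → N} {s t : ℝ} (hst : s ≤ t)
    (hγ : ContinuousOn γ (Set.Icc s t)) {y v : Plane}
    (hl : ∀ r ∈ Set.Icc s t, φ (γ r) = y + r • v) :
    edist (γ s) (γ t) ≤ ENNReal.ofReal ((t - s) * ‖v‖) := by
  have hloc := h.isLocalDiffeomorph hφ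
  have hc : ContDiff ℝ ∞ (fun r : ℝ => y + r • v) := by fun_prop
  -- The lift is locally the segment followed by a smooth local inverse of `φ`, so continuity
  -- upgrades to smoothness.
  have hsm : ContMDiffOn 𝓘(ℝ, ℝ) (𝓡 2) 1 γ (Set.Icc s t) := by
    intro r hr
    obtain ⟨Φ, hΦ, hΦe⟩ := hloc (γ r)
    have htar : y + r • v ∈ Φ.target := by
      rw [← hl r hr, hΦe hΦ]
      exact Φ.map_source hΦ
    have h1 : ContMDiffAt 𝓘(ℝ, ℝ) (𝓡 2) ∞ (fun r : ℝ => Φ.invFun (y + r • v)) r :=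
      (Φ.contMDiffOn_invFun.contMDiffAt (Φ.open_target.mem_nhds htar)).comp r
        hc.contDiffAt.contMDiffAt
    have h2 : γ =ᶠ[nhdsWithin r (Set.Icc s t)] fun r : ℝ => Φ.invFun (y + r • v) := by
      filter_upwards [(hγ r hr).preimage_mem_nhdsWithin (Φ.open_source.mem_nhds hΦ),
        self_mem_nhdsWithin] with u hu hu'
      rw [← hl u hu', hΦe hu]
      exact (Φ.left_inv hu).symm
    exact ((h1.contMDiffWithinAt).congr_of_eventuallyEq_of_mem h2 hr).of_le (by simp)
  rw [IsRiemannianManifold.out (I := 𝓡 2) (γ s) (γ t)]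
  refine (riemannianEDist_le_pathELength hsm rfl rfl hst).trans ?_
  rw [pathELength_eq_lintegral_mfderiv_Ioo]
  have hn : ∀ r ∈ Set.Ioo s t, ‖mfderiv 𝓘(ℝ, ℝ) (𝓡 2) γ r 1‖ₑ = ENNReal.ofReal ‖v‖ := by
    intro r hr
    have hrI : Set.Icc s t ∈ nhds r := Icc_mem_nhds hr.1 hr.2
    have h1 : MDifferentiableAt 𝓘(ℝ, ℝ) (𝓡 2) γ r :=
      (hsm.contMDiffAt hrI).mdifferentiableAt (by simp)
    have h2 : MDifferentiableAt (𝓡 2) (𝓡 2) φ (γ r) := (hφ _).mdifferentiableAt (by simp)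
    have h3 : HasMFDerivAt 𝓘(ℝ, ℝ) (𝓡 2) (φ ∘ γ) r
        ((mfderiv (𝓡 2) (𝓡 2) φ (γ r)).comp (mfderiv 𝓘(ℝ, ℝ) (𝓡 2) γ r)) :=
      h2.hasMFDerivAt.comp r h1.hasMFDerivAt
    have h4 : HasFDerivAt (fun r : ℝ => y + r • v) (ContinuousLinearMap.toSpanSingleton ℝ v) r :=
      ((hasFDerivAt_id r).smul_const v).const_add y
    have h5 : HasMFDerivAt 𝓘(ℝ, ℝ) (𝓡 2) (φ ∘ γ) r (ContinuousLinearMap.toSpanSingleton ℝ v) :=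
      h4.hasMFDerivAt.congr_of_eventuallyEq (by
        filter_upwards [hrI] with u hu
        exact hl u hu)
    have h6 : mfderiv (𝓡 2) (𝓡 2) φ (γ r) (mfderiv 𝓘(ℝ, ℝ) (𝓡 2) γ r 1) = v := by
      have h7 := DFunLike.congr_fun (hasMFDerivAt_unique h3 h5) (1 : ℝ)
      refine h7.trans ?_
      exact one_smul ℝ v
    rw [h.norm_eq h6, ofReal_norm]
  rw [MeasureTheory.setLIntegral_congr_fun measurableSet_Ioo hn, MeasureTheory.setLIntegral_const,
    Real.volume_Ioo, mul_comm, ← ENNReal.ofReal_mul (by linarith)]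

/-- Segments lift through a local isometry of a complete surface. -/
lemma PreservesMetric.exists_lift [CompleteSpace N] {φ : N → Plane} (h : PreservesMetric φ)
    (hφ : ContMDiff (𝓡 2) (𝓡 2) ∞ φ) (p : N) (v : Plane) :
    ∃ γ : ℝ → N, ContinuousOn γ (Set.Icc 0 1) ∧ γ 0 = p ∧
      ∀ r ∈ Set.Icc (0 : ℝ) 1, φ (γ r) = φ p + r • v := by
  have hloc := h.isLocalDiffeomorph hφ
  have hinj := hloc.isLocalHomeomorph.isLocallyInjective
  have hsep : IsSeparatedMap φ := T2Space.isSeparatedMap φ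
  have hc : Continuous (fun r : ℝ => φ p + r • v) := by fun_prop
  -- Continuous induction on the time up to which a lift exists: completeness closes `S` under
  -- limits, and local inverses of `φ` extend a lift past its endpoint.
  set S : Set ℝ := {t | ∃ γ : ℝ → N, ContinuousOn γ (Set.Icc 0 t) ∧ γ 0 = p ∧
      ∀ r ∈ Set.Icc (0 : ℝ) t, φ (γ r) = φ p + r • v} with hS
  have hdown : ∀ s t, s ≤ t → t ∈ S → s ∈ S := by
    rintro s t hst ⟨γ, hγ, h0, hl⟩
    exact ⟨γ, hγ.mono (Set.Icc_subset_Icc_right hst), h0,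
      fun r hr => hl r ⟨hr.1, hr.2.trans hst⟩⟩
  have h0S : (0 : ℝ) ∈ S := ⟨fun _ => p, continuousOn_const, rfl, fun r hr => by
    have : r = 0 := le_antisymm hr.2 hr.1
    simp [this]⟩
  have hlim : ∀ t, 0 < t → (∀ s < t, s ∈ S) → t ∈ S := by
    intro t ht hall
    have hall' : ∀ s : ℝ, ∃ γ : ℝ → N, s < t → ContinuousOn γ (Set.Icc 0 s) ∧ γ 0 = p ∧
        ∀ r ∈ Set.Icc (0 : ℝ) s, φ (γ r) = φ p + r • v := fun s => by
      by_cases hs : s < t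
      · obtain ⟨γ, hγ⟩ := hall s hs
        exact ⟨γ, fun _ => hγ⟩
      · exact ⟨fun _ => p, fun hs' => absurd hs' hs⟩
    choose Γ hΓ using hall'
    have hΓc := fun s hs => (hΓ s hs).1
    have hΓ0 := fun s hs => (hΓ s hs).2.1
    have hΓl := fun s hs => (hΓ s hs).2.2
    have hagree : ∀ s s', 0 ≤ s → s ≤ s' → s' < t → Γ s s = Γ s' s := by
      intro s s' hs hss' hs't
      have hst := hss'.trans_lt hs't
      refine hsep.eqOn_of_comp_eqOn hinj isPreconnected_Icc (hΓc s hst)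
        ((hΓc s' hs't).mono (Set.Icc_subset_Icc_right hss')) ?_ (Set.left_mem_Icc.2 hs) ?_
        (Set.right_mem_Icc.2 hs)
      · intro r hr
        exact (hΓl s hst r hr).trans (hΓl s' hs't r ⟨hr.1, hr.2.trans hss'⟩).symm
      · rw [hΓ0 s hst, hΓ0 s' hs't]
    -- The lifts agree where they overlap, so the diagonal glues them into one lift on `[0, t)`.
    set G : ℝ → N := fun s => Γ s s with hG
    have hGc : ContinuousOn G (Set.Ico 0 t) := by
      intro r hr
      obtain ⟨s, hrs, hst⟩ := exists_between hr.2
      have h1 : ContinuousWithinAt (Γ s) (Set.Icc 0 s) r := hΓc s hst r ⟨hr.1, hrs.le⟩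
      have h2 : ContinuousWithinAt G (Set.Icc 0 s) r :=
        h1.congr (fun u hu => hagree u s hu.1 hu.2 hst) (hagree r s hr.1 hrs.le hst)
      refine h2.mono_of_mem_nhdsWithin ?_
      filter_upwards [self_mem_nhdsWithin, mem_nhdsWithin_of_mem_nhds (Iio_mem_nhds hrs)]
        with u hu hu'
      exact ⟨hu.1, (Set.mem_Iio.1 hu').le⟩
    have hGl : ∀ r ∈ Set.Ico 0 t, φ (G r) = φ p + r • v := fun r hr =>
      hΓl r hr.2 r ⟨hr.1, le_rfl⟩
    have hdist : ∀ r s, 0 ≤ r → r ≤ s → s < t → dist (G r) (G s) ≤ (s - r) * ‖v‖ := by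
      intro r s hr hrs hst
      have h1 := h.edist_lift_le hφ hrs (hGc.mono fun u hu => ⟨hr.trans hu.1, hu.2.trans_lt hst⟩)
        (fun u hu => hGl u ⟨hr.trans hu.1, hu.2.trans_lt hst⟩)
      rw [edist_dist] at h1
      exact (ENNReal.ofReal_le_ofReal_iff (by nlinarith [norm_nonneg v])).1 h1
    have hcauchy : Cauchy (Filter.map G (nhdsWithin t (Set.Iio t))) := by
      refine Metric.cauchy_iff.2 ⟨inferInstance, fun ε hε => ?_⟩
      -- The added 1 covers the constant segment `v = 0`.
      have hv : 0 < ‖v‖ + 1 := by positivity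
      have hlt : max 0 (t - ε / (‖v‖ + 1)) < t := max_lt ht (by linarith [div_pos hε hv])
      refine ⟨G '' Set.Ioo (max 0 (t - ε / (‖v‖ + 1))) t,
        Filter.image_mem_map (Ioo_mem_nhdsLT hlt), ?_⟩
      have key : ∀ r ∈ Set.Ioo (max 0 (t - ε / (‖v‖ + 1))) t,
          ∀ s ∈ Set.Ioo (max 0 (t - ε / (‖v‖ + 1))) t, r ≤ s → dist (G r) (G s) < ε := by
        intro r hr s hs hrs
        have hr1 := (max_lt_iff.1 hr.1)
        have h1 := hdist r s hr1.1.le hrs hs.2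
        have h2 : s - r < ε / (‖v‖ + 1) := by linarith [hs.2, hr1.2]
        have h3 : (s - r) * (‖v‖ + 1) < ε := (lt_div_iff₀ hv).1 h2
        nlinarith
      rintro _ ⟨r, hr, rfl⟩ _ ⟨s, hs, rfl⟩
      rcases le_total r s with hrs | hrs
      · exact key r hr s hs hrs
      · rw [dist_comm]; exact key s hs r hr hrs
    obtain ⟨x, hx⟩ := CompleteSpace.complete hcauchy
    have hx' : Filter.Tendsto G (nhdsWithin t (Set.Iio t)) (nhds x) := hx
    refine ⟨Function.update G t x, ?_, ?_, ?_⟩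
    · rw [continuousOn_update_iff, Set.Icc_sdiff_right]
      exact ⟨hGc, fun _ => hx'.mono_left (nhdsWithin_mono _ fun u hu => hu.2)⟩
    · rw [Function.update_of_ne ht.ne]
      exact hΓ0 0 ht
    · intro r hr
      rcases hr.2.lt_or_eq with hrt | rfl
      · rw [Function.update_of_ne hrt.ne]
        exact hGl r ⟨hr.1, hrt⟩
      · rw [Function.update_self]
        refine tendsto_nhds_unique ((hφ.continuous.tendsto x).comp hx')
          (((hc.tendsto r).mono_left nhdsWithin_le_nhds).congr' ?_)
        filter_upwards [Ioo_mem_nhdsLT ht] with u hu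
        exact (hGl u ⟨hu.1.le, hu.2⟩).symm
  have hclosed : IsClosed (S ∩ Set.Icc 0 1) := by
    refine isClosed_of_closure_subset fun t ht => ?_
    have htI : t ∈ Set.Icc (0 : ℝ) 1 := closure_minimal Set.inter_subset_right isClosed_Icc ht
    refine ⟨?_, htI⟩
    rcases htI.1.eq_or_lt with rfl | hpos
    · exact h0S
    · refine hlim t hpos fun s hs => ?_
      obtain ⟨u, hu, hu'⟩ := mem_closure_iff.1 ht (Set.Ioi s) isOpen_Ioi hs
      exact hdown s u (le_of_lt hu) hu'.1
  refine hclosed.mem_of_ge_of_forall_exists_gt h0S zero_le_one fun t ht => ?_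
  obtain ⟨⟨γ, hγ, h0, hl⟩, ht0, ht1⟩ := ht
  obtain ⟨Φ, hΦ, hΦe⟩ := hloc (γ t)
  have hct : φ (γ t) = φ p + t • v := hl t ⟨ht0, le_rfl⟩
  have htar : φ p + t • v ∈ Φ.target := by
    rw [← hct, hΦe hΦ]
    exact Φ.map_source hΦ
  obtain ⟨ε, hε, hball⟩ := Metric.isOpen_iff.1 (Φ.open_target.preimage hc) t htar
  set t' := min 1 (t + ε / 2) with ht'
  have htt' : t < t' := lt_min ht1 (by linarith)
  have htar' : ∀ r ∈ Set.Icc t t', φ p + r • v ∈ Φ.target := fun r hr => by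
    refine hball (Metric.mem_ball.2 ?_)
    rw [Real.dist_eq, abs_of_nonneg (by linarith [hr.1])]
    linarith [hr.2, min_le_right 1 (t + ε / 2)]
  have hΦt : Φ.invFun (φ p + t • v) = γ t := by
    rw [← hct, hΦe hΦ]
    exact Φ.left_inv hΦ
  refine ⟨t', ⟨fun r => if r ≤ t then γ r else Φ.invFun (φ p + r • v), ?_, ?_, ?_⟩,
    htt', min_le_left _ _⟩
  · rw [← Set.Icc_union_Icc_eq_Icc ht0 htt'.le]
    refine ContinuousOn.union_of_isClosed ?_ ?_ isClosed_Icc isClosed_Icc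
    · exact hγ.congr fun r hr => if_pos hr.2
    · have : ContinuousOn (fun r : ℝ => Φ.invFun (φ p + r • v)) (Set.Icc t t') :=
        Φ.contMDiffOn_invFun.continuousOn.comp hc.continuousOn htar'
      refine this.congr fun r hr => ?_
      rcases hr.1.eq_or_lt with rfl | hlt
      · simp [hΦt]
      · exact if_neg (not_le.2 hlt)
  · simp [ht0, h0]
  · intro r hr
    by_cases hrt : r ≤ t
    · simpa [hrt] using hl r ⟨hr.1, hrt⟩
    · have hm := htar' r ⟨(not_le.1 hrt).le, hr.2⟩
      simp only [hrt, if_false]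
      exact (hΦe (Φ.map_target hm)).trans (Φ.right_inv hm)

/-- A local isometry of a complete connected surface into the plane is bijective. -/
lemma PreservesMetric.bijective [ConnectedSpace N] [CompleteSpace N] {φ : N → Plane}
    (h : PreservesMetric φ) (hφ : ContMDiff (𝓡 2) (𝓡 2) ∞ φ) : Function.Bijective φ := by
  obtain ⟨p⟩ : Nonempty N := inferInstance
  have hlh := (h.isLocalDiffeomorph hφ).isLocalHomeomorph
  have hsep : IsSeparatedMap φ := T2Space.isSeparatedMap φ
  choose γ hγ hγ0 hγl using fun x : Plane => h.exists_lift hφ p (x - φ p)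
  -- The lifts were chosen separately for each endpoint; homotopy lifting from the constant start
  -- `p` gives joint continuity. Their endpoints then form a continuous section of `φ`.
  have hg : Continuous (fun z : unitInterval × Plane => γ z.2 z.1) := by
    refine hlh.continuous_lift hsep
      ⟨fun z : unitInterval × Plane => φ p + (z.1 : ℝ) • (z.2 - φ p), by fun_prop⟩ ?_ ?_ ?_
    · funext z
      exact hγl z.2 z.1 z.1.2
    · simp only [Set.Icc.coe_zero, hγ0]
      exact continuous_const
    · intro x
      exact (hγ x).comp_continuous continuous_subtype_val fun t => t.2
  have hσ : Continuous (fun x => γ x 1) :=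
    hg.comp (f := fun x : Plane => ((1 : unitInterval), x)) (by fun_prop)
  have hφσ : ∀ x, φ (γ x 1) = x := fun x => by
    rw [hγl x 1 (by simp)]
    simp
  have hσp : γ (φ p) 1 = p := by
    refine (hsep.constOn_of_comp hlh.isLocallyInjective isPreconnected_Icc (hγ (φ p)) ?_
      (a := 1) (a' := 0) (by simp) (by simp)).trans (hγ0 (φ p))
    intro a ha a' ha'
    rw [hγl _ a ha, hγl _ a' ha']
    simp
  -- Both maps lift `φ` through itself and agree at `p`, so they coincide on the connected `N`.
  have hσφ : (fun x => γ x 1) ∘ φ = id :=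
    hsep.eq_of_comp_eq hlh.isLocallyInjective (hσ.comp hφ.continuous) continuous_id
      (funext fun q => hφσ (φ q)) p hσp
  exact ⟨(Function.leftInverse_iff_comp.2 hσφ).injective,
    (Function.RightInverse.surjective (g := fun x => γ x 1) hφσ)⟩

end LocalIsometry

/-! ### The motion to standard position and the projection to the plane. -/

/-- The null vector `u₀ + u₁`. -/
def stdNull : R41 := ![1, 1, 0, 0]

lemma minkowski_stdNull (x : R41) : minkowski x stdNull = x 1 - x 0 := by
  simp [minkowski, stdNull]; ring

/-- The reflection of Minkowski space in the hyperplane orthogonal to `w`. -/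
noncomputable def reflect (w : R41) : R41 →ₗ[ℝ] R41 where
  toFun x := x - (2 * minkowski x w / minkowski w w) • w
  map_add' x y := by
    have : minkowski (x + y) w = minkowski x w + minkowski y w := by
      simp only [minkowski, Pi.add_apply]; ring
    rw [this]
    module
  map_smul' t x := by
    rw [minkowski_smul_left, RingHom.id_apply]
    module

lemma reflect_apply (w x : R41) :
    reflect w x = x - (2 * minkowski x w / minkowski w w) • w := rfl

lemma minkowski_sub_left (x y z : R41) : minkowski (x - y) z = minkowski x z - minkowski y z := by
  rw [minkowski_comm, minkowski_sub_right, minkowski_comm z, minkowski_comm z]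

lemma minkowski_reflect (w x y : R41) :
    minkowski (reflect w x) (reflect w y) = minkowski x y := by
  simp only [reflect_apply, minkowski_sub_left, minkowski_sub_right, minkowski_smul_left,
    minkowski_smul_right, minkowski_comm w y]
  -- For null `w` the division by zero makes `reflect w` the identity, so no case is excluded.
  rcases eq_or_ne (minkowski w w) 0 with h | h
  · simp [h]
  · field_simp
    ring

lemma reflect_involutive (w : R41) : Function.Involutive (reflect w) := by
  intro x
  rw [reflect_apply w (reflect w x)]
  simp only [reflect_apply, minkowski_sub_left, minkowski_smul_left]
  rcases eq_or_ne (minkowski w w) 0 with h | h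
  · simp [h]
  · have : 2 * (minkowski x w - 2 * minkowski x w / minkowski w w * minkowski w w) / minkowski w w
        = -(2 * minkowski x w / minkowski w w) := by
      field_simp
      ring
    rw [this]
    module

/-- Reflection in the difference of two vectors of equal square swaps them. It degenerates only if
`⟨k, stdNull⟩ = 0`, and then the normalization forces `k = stdNull`. -/
lemma reflect_null {k : R41} (h0 : k 0 = 1) (hk : minkowski k k = 0) :
    reflect (k - stdNull) k = stdNull := by
  have hss : minkowski stdNull stdNull = 0 := by simp [minkowski, stdNull]
  have hkw : minkowski k (k - stdNull) = -minkowski k stdNull := by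
    rw [minkowski_sub_right, hk, zero_sub]
  have hww : minkowski (k - stdNull) (k - stdNull) = -2 * minkowski k stdNull := by
    rw [minkowski_sub_left, minkowski_sub_right, minkowski_sub_right, hk, hss,
      minkowski_comm stdNull k]
    ring
  rw [reflect_apply, hkw, hww]
  rcases eq_or_ne (minkowski k stdNull) 0 with h | h
  · rw [minkowski_stdNull, h0] at h
    have h1 : k 1 = 1 := by linarith
    have h23 : k 2 ^ 2 + k 3 ^ 2 = 0 := by
      simp only [minkowski, h0, h1] at hk
      linarith
    have h2 : k 2 = 0 := by nlinarith [sq_nonneg (k 2), sq_nonneg (k 3)]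
    have h3 : k 3 = 0 := by nlinarith [sq_nonneg (k 2), sq_nonneg (k 3)]
    have : k = stdNull := by
      funext i
      fin_cases i
      exacts [h0, h1, h2, h3]
    simp [this]
  · have : 2 * -minkowski k stdNull / (-2 * minkowski k stdNull) = 1 := by field_simp
    rw [this]
    module

/-- The projection of Minkowski space to its last two coordinates. -/
noncomputable def planeProj : R41 →L[ℝ] Plane :=
  ((EuclideanSpace.equiv (Fin 2) ℝ).symm : (Fin 2 → ℝ) →L[ℝ] Plane).comp
    (ContinuousLinearMap.pi ![ContinuousLinearMap.proj 2, ContinuousLinearMap.proj 3])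

lemma planeProj_zero (x : R41) : planeProj x 0 = x 2 := rfl

lemma planeProj_one (x : R41) : planeProj x 1 = x 3 := rfl

lemma inner_planeProj {x y : R41} (hx : x 0 = x 1) (hy : y 0 = y 1) :
    (inner ℝ (planeProj x) (planeProj y) : ℝ) = minkowski x y := by
  simp only [PiLp.inner_apply, Fin.sum_univ_two, planeProj_zero, planeProj_one, minkowski, hx, hy]
  simp
  ring

lemma eq_nullGraph {lam : Plane → ℝ} {x : R41} {z : Plane} (h01 : x 0 = x 1) (hz : planeProj x = z)
    (hl : lam z = x 0) : x = nullGraph lam z := by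
  subst hz
  funext i
  fin_cases i
  · exact hl.symm
  · exact h01.symm.trans hl.symm
  · rfl
  · rfl

/-- A smooth function on an open subset of the plane agrees near any of its points with a smooth
function on the plane. -/
lemma exists_contDiff_eqOn {u : Plane → ℝ} {T : Set Plane} (hT : IsOpen T)
    (hu : ContDiffOn ℝ ∞ u T) {z : Plane} (hz : z ∈ T) :
    ∃ lam : Plane → ℝ, ContDiff ℝ ∞ lam ∧ ∃ B : Set Plane, IsOpen B ∧ z ∈ B ∧ Set.EqOn lam u B := by
  obtain ⟨r, hr, hball⟩ := Metric.isOpen_iff.1 hT z hz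
  -- The closed ball of radius `r / 2` supports the cutoff and lies in `T`, so smoothness of the
  -- product is needed only where `u` is smooth.
  let b : ContDiffBump z := ⟨r / 4, r / 2, by linarith, by linarith⟩
  refine ⟨fun y => b y * u y, contMDiff_iff_contDiff.1 (contMDiff_of_tsupport fun y hy => ContDiffAt.contMDiffAt ?_), Metric.ball z (r / 4),
    Metric.isOpen_ball, Metric.mem_ball_self (by linarith), fun y hy => ?_⟩
  · have h1 : y ∈ tsupport b := tsupport_mul_subset_left hy
    rw [b.tsupport_eq] at h1
    have h2 : y ∈ T := hball (Metric.closedBall_subset_ball (by change r / 2 < r; linarith) h1)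
    exact b.contDiff.contDiffAt.mul (hu.contDiffAt (hT.mem_nhds h2))
  · have : b y = 1 := b.one_of_mem_closedBall (Metric.ball_subset_closedBall hy)
    simp [this]

/-- The motion carrying the constant null direction `k` to `u₀ + u₁` and `x₀` to the origin. -/
noncomputable def nullMotion (k x₀ : R41) : R41 ≃ᵃ[ℝ] R41 :=
  (LinearEquiv.ofInvolutive (reflect (k - stdNull)) (reflect_involutive _)).toAffineEquiv.trans
    (AffineEquiv.constVAdd ℝ R41 (-reflect (k - stdNull) x₀))

lemma nullMotion_apply (k x₀ x : R41) : nullMotion k x₀ x = reflect (k - stdNull) (x - x₀) := by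
  rw [map_sub, sub_eq_neg_add]
  rfl

lemma isMinkowskiIsometry_nullMotion (k x₀ : R41) : IsMinkowskiIsometry (nullMotion k x₀) :=
  fun v w => minkowski_reflect (k - stdNull) v w

/-- The image is orthogonal to the image `u₀ + u₁` of `k`. -/
lemma reflect_zero_eq_one {k x : R41} (h0 : k 0 = 1) (hk : minkowski k k = 0)
    (hx : minkowski k x = 0) : reflect (k - stdNull) x 0 = reflect (k - stdNull) x 1 := by
  have h := minkowski_reflect (k - stdNull) x k
  rw [reflect_null h0 hk, minkowski_stdNull, minkowski_comm, hx] at h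
  linarith

lemma contDiff_nullMotion (k x₀ : R41) : ContDiff ℝ ∞ (nullMotion k x₀) := by
  have : (nullMotion k x₀ : R41 → R41)
      = fun x => (reflect (k - stdNull)).toContinuousLinearMap (x - x₀) :=
    funext fun x => nullMotion_apply k x₀ x
  rw [this]
  fun_prop

/-! ### The surface as a null graph. -/

section Surface

variable {N : Type*} [MetricSpace N] [ChartedSpace Plane N]

lemma isNullGraphNear {f : N → R41} {Φ : R41 ≃ᵃ[ℝ] R41}
    (hs : ContMDiff (𝓡 2) 𝓘(ℝ, R41) ∞ (fun q => Φ (f q))) (h01 : ∀ q, Φ (f q) 0 = Φ (f q) 1)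
    (hloc : IsLocalDiffeomorph (𝓡 2) (𝓡 2) ∞ (fun q => planeProj (Φ (f q)))) (p : N) :
    IsNullGraphNear f Φ p := by
  obtain ⟨ψ, hp, he⟩ := hloc p
  have hu : ContDiffOn ℝ ∞ (fun z => Φ (f (ψ.invFun z)) 0) ψ.target := by
    rw [← contMDiffOn_iff_contDiffOn]
    have h1 : ContMDiff (𝓡 2) 𝓘(ℝ, ℝ) ∞ (fun q => Φ (f q) 0) :=
      (contDiff_coord 0).contMDiff.comp hs
    exact h1.comp_contMDiffOn ψ.contMDiffOn_invFun
  -- The height is defined only on `ψ.target`; a cutoff extends it to the plane at the price of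
  -- shrinking the chart to `B`.
  obtain ⟨lam, hlam, B, hB, hpB, heq⟩ :=
    exists_contDiff_eqOn ψ.open_target hu (ψ.map_source hp)
  refine ⟨lam, hlam, ψ.toOpenPartialHomeomorph.trans (OpenPartialHomeomorph.ofSet B hB),
    ⟨hp, hpB⟩, ?_, ?_, fun q hq => ?_⟩
  · exact ψ.contMDiffOn_toFun.mono fun q hq => hq.1
  · exact ψ.contMDiffOn_invFun.mono fun z hz => hz.2
  · refine eq_nullGraph (h01 q) (he hq.1) ((heq hq.2).trans ?_)
    have : ψ.invFun (ψ q) = q := ψ.left_inv hq.1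
    change Φ (f (ψ.invFun (ψ q))) 0 = _
    rw [this]

variable [RiemannianBundle (fun p : N => TangentSpace (𝓡 2) p)]

/-- The coordinates of the surface in the plane of the last two coordinates. -/
noncomputable def planeMap (f : N → R41) (k x₀ : R41) (q : N) : Plane :=
  planeProj (nullMotion k x₀ (f q))

lemma contMDiff_nullMotion {f : N → R41} (hf : IsIsometricImmersion f) (k x₀ : R41) :
    ContMDiff (𝓡 2) 𝓘(ℝ, R41) ∞ (fun q => nullMotion k x₀ (f q)) :=
  (contDiff_nullMotion k x₀).contMDiff.comp hf.smooth

lemma contMDiff_planeMap {f : N → R41} (hf : IsIsometricImmersion f) (k x₀ : R41) :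
    ContMDiff (𝓡 2) (𝓡 2) ∞ (planeMap f k x₀) :=
  planeProj.contDiff.contMDiff.comp (contMDiff_nullMotion hf k x₀)

/-- Tangent vectors are orthogonal to `k`, so after the reflection their first two coordinates agree
and cancel in the metric. -/
lemma preservesMetric_planeMap {f : N → R41} (hf : IsIsometricImmersion f) {k : R41}
    (h0 : k 0 = 1) (hk : minkowski k k = 0)
    (hn : ∀ q v, minkowski k (differential f q v) = 0) (x₀ : R41) :
    PreservesMetric (planeMap f k x₀) := by
  intro p v w
  set A : R41 →L[ℝ] R41 := (reflect (k - stdNull)).toContinuousLinearMap with hA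
  have h1 : HasFDerivAt (fun x => planeProj (nullMotion k x₀ x)) (planeProj.comp A) (f p) := by
    have : (fun x => planeProj (nullMotion k x₀ x)) = fun x => (planeProj.comp A) (x - x₀) :=
      funext fun x => by rw [nullMotion_apply]; rfl
    rw [this]
    exact (planeProj.comp A).hasFDerivAt.comp (f p) ((hasFDerivAt_id (f p)).sub_const x₀)
  have h2 : HasMFDerivAt (𝓡 2) (𝓡 2) (planeMap f k x₀) p
      ((planeProj.comp A).comp (differential f p)) :=
    HasMFDerivAt.comp (g := fun x => planeProj (nullMotion k x₀ x)) (f := f) p h1.hasMFDerivAt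
      ((hf.smooth p).mdifferentiableAt (by simp)).hasMFDerivAt
  rw [h2.mfderiv, ← hf.isometric p v w, ← minkowski_reflect (k - stdNull)]
  exact inner_planeProj (reflect_zero_eq_one h0 hk (hn p v)) (reflect_zero_eq_one h0 hk (hn p w))

lemma minkowski_const [ConnectedSpace N] [IsManifold (𝓡 2) ∞ N] {f : N → R41} (hf : IsIsometricImmersion f) {k : R41}
    (hk : ∀ q v, minkowski k (differential f q v) = 0) (p q : N) :
    minkowski k (f q - f p) = 0 := by
  have : IsManifold (𝓡 2) 1 N := IsManifold.of_le (n := ∞) (by simp)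
  have hd : ∀ q, HasMFDerivAt (𝓡 2) 𝓘(ℝ, ℝ) (fun q => minkowskiL k (f q)) q
      ((minkowskiL k).comp (differential f q)) := fun q =>
    HasMFDerivAt.comp q (minkowskiL k).hasFDerivAt.hasMFDerivAt
      ((hf.smooth q).mdifferentiableAt (by simp)).hasMFDerivAt
  have h := eq_of_mfderiv_eq_zero (fun q => (hd q).mdifferentiableAt)
    (fun q => (hd q).mfderiv.trans (ContinuousLinearMap.ext fun v => hk q v)) q p
  rw [minkowski_sub_right]
  exact sub_eq_zero.2 h

end Surface

end MinkowskiSurface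

theorem mainTheorem6 {N : Type*} [MetricSpace N] [ConnectedSpace N]
    [ChartedSpace MinkowskiSurface.Plane N] [IsManifold (𝓡 2) ∞ N]
    [RiemannianBundle (fun p : N => TangentSpace (𝓡 2) p)]
    [IsContMDiffRiemannianBundle (𝓡 2) ∞ MinkowskiSurface.Plane
      (fun p : N => TangentSpace (𝓡 2) p)]
    [IsRiemannianManifold (𝓡 2) N]
    (o : (p : N) → Orientation ℝ (TangentSpace (𝓡 2) p) (Fin 2))
    (ho : MinkowskiSurface.IsSurfaceOrientation o)
    (f : N → MinkowskiSurface.R41) (hf : MinkowskiSurface.IsIsometricImmersion f)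
    (hiso : MinkowskiSurface.IsPlusIsotropic o f) :
    (CompleteSpace N → ∃ φ : N ≃ₘ^∞⟮𝓡 2, 𝓡 2⟯ MinkowskiSurface.Plane,
      MinkowskiSurface.IsIsometryToPlane φ) ∧
    ∃ Φ : MinkowskiSurface.R41 ≃ᵃ[ℝ] MinkowskiSurface.R41,
      MinkowskiSurface.IsMinkowskiIsometry Φ ∧
      (∀ p : N, MinkowskiSurface.IsNullGraphNear f Φ p) ∧
      (CompleteSpace N → ∃ φ : N ≃ₘ^∞⟮𝓡 2, 𝓡 2⟯ MinkowskiSurface.Plane,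
        MinkowskiSurface.IsIsometryToPlane φ ∧
        ∃ lam : MinkowskiSurface.Plane → ℝ, ContDiff ℝ ∞ lam ∧
          ∀ q : N, Φ (f q) = MinkowskiSurface.nullGraph lam (φ q)) := by
  open MinkowskiSurface in
  obtain ⟨k, hk⟩ := exists_normalNull ho hf hiso
  obtain ⟨p₀⟩ : Nonempty N := inferInstance
  have h0 := (hk p₀).zero
  have hkk := (hk p₀).null
  have hn := fun q => (hk q).normal
  have hpres := preservesMetric_planeMap hf h0 hkk hn (f p₀)
  have hsm := contMDiff_planeMap hf k (f p₀)
  have hs := contMDiff_nullMotion hf k (f p₀)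
  have hloc := hpres.isLocalDiffeomorph hsm
  -- Moving `f p₀` to the origin makes the two coordinates equal, not merely equal up to a constant.
  have h01 : ∀ q, nullMotion k (f p₀) (f q) 0 = nullMotion k (f p₀) (f q) 1 := fun q => by
    rw [nullMotion_apply]
    exact reflect_zero_eq_one h0 hkk (minkowski_const hf hn p₀ q)
  have hcomplete : CompleteSpace N → ∃ φ : N ≃ₘ^∞⟮𝓡 2, 𝓡 2⟯ Plane, IsIsometryToPlane φ ∧
      ∃ lam : Plane → ℝ, ContDiff ℝ ∞ lam ∧
        ∀ q : N, nullMotion k (f p₀) (f q) = nullGraph lam (φ q) := by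
    intro _
    obtain ⟨φ, hφ⟩ : ∃ φ : N ≃ₘ^∞⟮𝓡 2, 𝓡 2⟯ Plane, (φ : N → Plane) = planeMap f k (f p₀) :=
      ⟨hloc.diffeomorphOfBijective (hpres.bijective hsm), rfl⟩
    refine ⟨φ, ?_, fun z => nullMotion k (f p₀) (f (φ.symm z)) 0, ?_, fun q => ?_⟩
    · intro p v w
      rw [hφ]
      exact hpres p v w
    · rw [← contMDiff_iff_contDiff]
      exact (contDiff_coord 0).contMDiff.comp (hs.comp φ.symm.contMDiff)
    · refine eq_nullGraph (h01 q) (congrFun hφ q).symm ?_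
      simp
  exact ⟨fun h => (hcomplete h).imp fun φ hφ => hφ.1, nullMotion k (f p₀),
    isMinkowskiIsometry_nullMotion k (f p₀), isNullGraphNear hs h01 hloc, hcomplete⟩
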